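/- **Extensional realizability.** Let $\{e\}(n)$ denote the result (possibly undefined) of applying the $e$-th partial computable function to $n$, and let $e\mapsto (e_0,e_1)$ be the decoding of a computable pairing $\mathbb N^2\cong\mathbb N$. In $\mathbf{Ext}$, both objects $X$ and propositions $P$ are partial equivalence relations (symmetric transitive relations, PERs) $\sim_X$, $\sim_P$ on the set of natural numbers. The numbers $a$ with $a\sim_X a$ are the *names* of elements of $X$, and the elements of $X$ are the equivalence classes of names; the numbers $e$ with $e\sim_P e$ are the *realizers* of $P$, and $P$ is *realized* if it has a realizer. The object $\mathbb N$ is equality on the natural numbers. The function space $Y^X$ is given by: $e\sim e'$ iff for all $a\sim_X a'$, $\{e\}(a)$ and $\{e'\}(a')$ are defined and $\{e\}(a)\sim_Y\{e'\}(a')$. So $\mathbb N^{\mathbb N}$ consists of the total computable functions, and an element of $\mathbb N^{(\mathbb N^{\mathbb N})}$ is named by an index that is defined and extensional on indices of total computable functions. Propositions are interpreted as follows. * A prime arithmetical formula (a numerical equation or inequality) is the total relation on $\mathbb N$ if it is true and the empty relation if it is false. * $P\to Q$ is the function space, and $\neg P$ is $P\to 0=1$. * $e\sim_{P\wedge Q}e'$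 iff $e_0\sim_P e_0'$ and $e_1\sim_Q e_1'$. * $e\sim_{P\vee Q}e'$ iff ($e_0=e_0'=0$ and $e_1\sim_P e'_1$) or ($e_0=e_0'=1$ and $e_1\sim_Q e'_1$). * $e\sim_{\forall x\in X\,\varphi(x)}e'$ iff for every element $x$ of $X$ and all names $a,a'$ of $x$, $\{e\}(a)$ and $\{e'\}(a')$ are defined and $\{e\}(a)\sim_{\varphi(x)}\{e'\}(a')$. * $e\sim_{\exists x\in X\,\varphi(x)}e'$ iff there is an element $x$ of $X$ with names $e_0$ and $e'_0$ such that $e_1\sim_{\varphi(x)}e'_1$. * A subset $A\subseteq\mathbb N$ of $\mathbf{Ext}$ assigns to each $n\in\mathbb N$ a proposition $n\in A$, and $e\sim_{\forall A\subseteq\mathbb N\,\varphi(A)}e'$ iff $e\sim_{\varphi(A)}e'$ for every such $A$. **The principle.** For $A\subseteq\mathbb N$, "$A$ is countable" means $\exists a\in\mathbb N^{\mathbb N}\,\forall m\,(m\in A\leftrightarrow\exists k\;a(k)=m)$. "$A$ is pseudo-bounded" means that every sequence $s\in\mathbb N^{\mathbb N}$ of members of $A$ satisfies $\lim_n s(n)/n=0$,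 that is, $\forall k\,\exists N\,\forall n\ge N\;(k+1)\,s(n)<n$. "$A$ is bounded" means $\exists B\,\forall m\,(m\in A\to m\le B)$. BD-$\mathbb N$ is the proposition: for all $A\subseteq\mathbb N$, if $A$ is countable and pseudo-bounded, then $A$ is bounded. For $F:\mathbb N^{\mathbb N}\to\mathbb N$ in $\mathbf{Ext}$, let $A_F\subseteq\mathbb N$ be given by $$m\in A_F\;:\iff\; m=0\ \vee\ \exists g\in\mathbb N^{\mathbb N}\,\bigl(\forall x<m\;g(x)=0\ \wedge\ \exists N\,\forall n\ge N\;g(n)=0\ \wedge\ \neg\, F(g)=F(\mathbf 0)\bigr),$$ where $\mathbf 0$ is the constant function $0$; the right-hand side is interpreted in $\mathbf{Ext}$. **Theorem.** In $\mathbf{Ext}$, BD-$\mathbb N$ is false: BD-$\mathbb N$ is not realized, and $\neg$BD-$\mathbb N$ is realized. Explicitly, the sets $A_F$ form a uniform counterexample: 1. "For every $F:\mathbb N^{\mathbb N}\to\mathbb N$, the set $A_F$ is countable and pseudo-bounded" is realized. That is, from an index $z$ of $F$ one can compute, extensionally in $z$, a realizer of the countability and of the pseudo-boundedness of $A_F$.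 2. "For every $F:\mathbb N^{\mathbb N}\to\mathbb N$, the set $A_F$ is bounded" is not realized. -/

import Mathlib

/-!
Extensional realizability `Ext`: objects and propositions are partial equivalence relations (PERs)
on the natural numbers, where natural numbers also serve as codes of partial computable functions.
-/

namespace ExtReal

/-- Kleene application `{e}(n)`: run the `e`-th partial computable function on input `n`. -/
def app (e n : ℕ) : Part ℕ :=
  (Denumerable.ofNat Nat.Partrec.Code e).eval n

/-- First component of a coded pair. -/
def fst (n : ℕ) : ℕ := n.unpair.1

/-- Second component of a coded pair. -/
def snd (n : ℕ) : ℕ := n.unpair.2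

/-- A partial equivalence relation on the natural numbers. As an object, `rel a b` says that `a` and
`b` are extensionally equal names of one element; as a proposition, it says that `a` and `b` are
extensionally equal realizers. -/
structure PER where
  rel : ℕ → ℕ → Prop
  symm : ∀ a b, rel a b → rel b a
  trans : ∀ a b c, rel a b → rel b c → rel a c

namespace PER

/-- The equivalence relation of extensional equality on the domain of a PER. -/
def setoid (X : PER) : Setoid {n : ℕ // X.rel n n} where
  r a b := X.rel a.1 b.1
  iseqv := ⟨fun a => a.2, fun h => X.symm _ _ h, fun h k => X.trans _ _ _ h k⟩

/-- The elements of an object: names modulo extensional equality. -/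
def El (X : PER) : Type := Quotient X.setoid

/-- The element with a given name. -/
def elem (X : PER) (n : ℕ) (h : X.rel n n) : X.El := Quotient.mk X.setoid ⟨n, h⟩

/-- `n` is a name of the element `x`. -/
def Names {X : PER} (x : X.El) (n : ℕ) : Prop := ∃ h : X.rel n n, X.elem n h = x

/-- The object `ℕ`: extensional equality is equality. -/
def nat : PER where
  rel a b := a = b
  symm _ _ h := h.symm
  trans _ _ _ h k := h.trans k

/-- The function space `Y ^ X`, and also the implication `X → Y`: codes that are defined on all names
(realizers) and send extensionally equal inputs to extensionally equal outputs. -/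
def arrow (X Y : PER) : PER where
  rel e e' := ∀ a a', X.rel a a' → ∃ u ∈ app e a, ∃ v ∈ app e' a', Y.rel u v
  symm e e' h a a' ha := by
    obtain ⟨u, hu, v, hv, huv⟩ := h a' a (X.symm _ _ ha)
    exact ⟨v, hv, u, hu, Y.symm _ _ huv⟩
  trans e e' e'' h k a a' ha := by
    obtain ⟨u, hu, v, hv, huv⟩ := h a a (X.trans _ _ _ ha (X.symm _ _ ha))
    obtain ⟨v', hv', w, hw, hvw⟩ := k a a' ha
    obtain rfl : v = v' := Part.mem_unique hv hv'
    exact ⟨u, hu, w, hw, Y.trans _ _ _ huv hvw⟩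

/-- Conjunction: pairs of realizers. -/
def and (P Q : PER) : PER where
  rel e e' := P.rel (fst e) (fst e') ∧ Q.rel (snd e) (snd e')
  symm _ _ h := ⟨P.symm _ _ h.1, Q.symm _ _ h.2⟩
  trans _ _ _ h k := ⟨P.trans _ _ _ h.1 k.1, Q.trans _ _ _ h.2 k.2⟩

/-- Disjunction: a tag `0` or `1`, with a realizer of the disjunct that it indicates. -/
def or (P Q : PER) : PER where
  rel e e' := (fst e = 0 ∧ fst e' = 0 ∧ P.rel (snd e) (snd e')) ∨
    (fst e = 1 ∧ fst e' = 1 ∧ Q.rel (snd e) (snd e'))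
  symm _ _ h := by
    rcases h with ⟨h, k, r⟩ | ⟨h, k, r⟩
    · exact Or.inl ⟨k, h, P.symm _ _ r⟩
    · exact Or.inr ⟨k, h, Q.symm _ _ r⟩
  trans _ _ _ h k := by
    rcases h with ⟨h1, h2, r⟩ | ⟨h1, h2, r⟩ <;> rcases k with ⟨k1, k2, s⟩ | ⟨k1, k2, s⟩
    · exact Or.inl ⟨h1, k2, P.trans _ _ _ r s⟩
    · omega
    · omega
    · exact Or.inr ⟨h1, k2, Q.trans _ _ _ r s⟩

/-- A prime formula (an equation or inequality between natural numbers): if it is true, everything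
realizes it, all realizers being extensionally equal; if it is false, nothing does. -/
def atom (p : Prop) : PER where
  rel _ _ := p
  symm _ _ h := h
  trans _ _ _ h _ := h

/-- Negation: `P` implies a false equation. -/
def neg (P : PER) : PER := arrow P (atom ((0 : ℕ) = 1))

/-- Logical equivalence. -/
def iff (P Q : PER) : PER := and (arrow P Q) (arrow Q P)

/-- `∀ x ∈ X, φ x`: a realizer takes a name of `x` to a realizer of `φ x`, extensionally. -/
def all (X : PER) (φ : X.El → PER) : PER where
  rel e e' := ∀ (x : X.El) (a a' : ℕ), Names x a → Names x a' →
    ∃ u ∈ app e a, ∃ v ∈ app e' a', (φ x).rel u v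
  symm e e' h x a a' ha ha' := by
    obtain ⟨u, hu, v, hv, huv⟩ := h x a' a ha' ha
    exact ⟨v, hv, u, hu, (φ x).symm _ _ huv⟩
  trans e e' e'' h k x a a' ha ha' := by
    obtain ⟨u, hu, v, hv, huv⟩ := h x a a ha ha
    obtain ⟨v', hv', w, hw, hvw⟩ := k x a a' ha ha'
    obtain rfl : v = v' := Part.mem_unique hv hv'
    exact ⟨u, hu, w, hw, (φ x).trans _ _ _ huv hvw⟩

/-- `∃ x ∈ X, φ x`: a realizer is a name of some `x` paired with a realizer of `φ x`. -/
def ex (X : PER) (φ : X.El → PER) : PER where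
  rel e e' := ∃ x : X.El, Names x (fst e) ∧ Names x (fst e') ∧ (φ x).rel (snd e) (snd e')
  symm _ _ h := by
    obtain ⟨x, h1, h2, h3⟩ := h
    exact ⟨x, h2, h1, (φ x).symm _ _ h3⟩
  trans _ _ _ h k := by
    obtain ⟨x, h1, ⟨p, h2⟩, h3⟩ := h
    obtain ⟨y, ⟨q, k1⟩, k2, k3⟩ := k
    obtain rfl : x = y := h2.symm.trans k1
    exact ⟨x, h1, k2, (φ x).trans _ _ _ h3 k3⟩

/-- `∀ A ⊆ ℕ, φ A`. A subset of `ℕ` assigns to each number the proposition that it is a member. Sets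
have no names, so a realizer has to realize every `φ A` uniformly. -/
def allSet (φ : (ℕ → PER) → PER) : PER where
  rel e e' := ∀ A : ℕ → PER, (φ A).rel e e'
  symm _ _ h A := (φ A).symm _ _ (h A)
  trans _ _ _ h k A := (φ A).trans _ _ _ (h A) (k A)

/-- A proposition is true in `Ext` if it has a realizer. -/
def Realized (P : PER) : Prop := ∃ e : ℕ, P.rel e e

theorem app_dom {X Y : PER} {e a : ℕ} (he : (arrow X Y).rel e e) (ha : X.rel a a) :
    (app e a).Dom := by
  obtain ⟨u, hu, -⟩ := he a a ha
  exact Part.dom_iff_mem.2 ⟨u, hu⟩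

theorem app_rel {X Y : PER} {e e' a a' : ℕ} (he : (arrow X Y).rel e e') (ha : X.rel a a')
    (h : (app e a).Dom) (h' : (app e' a').Dom) :
    Y.rel ((app e a).get h) ((app e' a').get h') := by
  obtain ⟨u, hu, v, hv, huv⟩ := he a a' ha
  rw [Part.get_eq_of_mem hu h, Part.get_eq_of_mem hv h']
  exact huv

/-- The value `f x ∈ Y` of `f ∈ Y ^ X` at `x ∈ X`, named by `{e}(a)` if `e` names `f` and `a`
names `x`. -/
def ev {X Y : PER} (f : (arrow X Y).El) (x : X.El) : Y.El :=
  Quotient.lift₂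
    (fun (e : {n : ℕ // (arrow X Y).rel n n}) (a : {n : ℕ // X.rel n n}) =>
      Y.elem ((app e.1 a.1).get (app_dom e.2 a.2))
        (app_rel e.2 a.2 (app_dom e.2 a.2) (app_dom e.2 a.2)))
    (fun e a e' a' he ha => Quotient.sound (s := Y.setoid)
      (app_rel (e := e.1) (e' := e'.1) (a := a.1) (a' := a'.1) he ha
        (app_dom e.2 a.2) (app_dom e'.2 a'.2)))
    f x

/-- The natural number that an element of the object `ℕ` is. -/
def num (x : nat.El) : ℕ :=
  Quotient.lift (fun n : {n : ℕ // nat.rel n n} => n.1) (fun _ _ h => h) x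

/-- A natural number as an element of the object `ℕ`. -/
def lit (n : ℕ) : nat.El := nat.elem n rfl

/-- `∀ n ∈ ℕ, φ n`. -/
def allNat (φ : ℕ → PER) : PER := all nat fun n => φ (num n)

/-- `∃ n ∈ ℕ, φ n`. -/
def exNat (φ : ℕ → PER) : PER := ex nat fun n => φ (num n)

/-- The object `ℕ^ℕ`. -/
def baire : PER := arrow nat nat

/-- The value of `f ∈ ℕ^ℕ` at a number. -/
def val (f : baire.El) (n : ℕ) : ℕ := num (ev f (lit n))

/-- The constant function `0` in `ℕ^ℕ`. -/
def zeroFun : baire.El :=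
  baire.elem (Encodable.encode Nat.Partrec.Code.zero) (by
    intro a a' _
    refine ⟨0, ?_, 0, ?_, rfl⟩ <;>
      · rw [app, Denumerable.ofNat_encode]
        exact Part.mem_some 0)

/-- The object of functionals from `ℕ^ℕ` to `ℕ`. -/
def functional : PER := arrow baire nat

/-- The value of a functional at an element of `ℕ^ℕ`. -/
def fval (F : functional.El) (g : baire.El) : ℕ := num (ev F g)

end PER

open PER

/-- "`A` is countable": `A` is the range of a function from `ℕ` to `ℕ`. -/
def countable (A : ℕ → PER) : PER :=
  ex baire fun a => allNat fun m => iff (A m) (exNat fun k => atom (val a k = m))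

/-- "`lim s n / n = 0`": for each `k` there is `N` with `s n / n < 1 / (k + 1)` for all `n ≥ N`;
the denominators are cleared (at `n = 0` the inequality is false, so `N` has to be positive). -/
def seqPseudoBounded (s : baire.El) : PER :=
  allNat fun k => exNat fun N => allNat fun n =>
    arrow (atom (N ≤ n)) (atom ((k + 1) * val s n < n))

/-- "`A` is pseudo-bounded": every sequence of members of `A` is pseudo-bounded. -/
def pseudoBounded (A : ℕ → PER) : PER :=
  all baire fun s => arrow (allNat fun n => A (val s n)) (seqPseudoBounded s)

/-- "`A` is bounded". -/
def bounded (A : ℕ → PER) : PER :=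
  exNat fun B => allNat fun m => arrow (A m) (atom (m ≤ B))

/-- The principle BD-ℕ: every countable pseudo-bounded set of natural numbers is bounded. -/
def BDN : PER :=
  allSet fun A => arrow (and (countable A) (pseudoBounded A)) (bounded A)

/-- "`g` extends `0^m`": `g x = 0` for all `x < m`. -/
def extendsZeros (g : baire.El) (m : ℕ) : PER :=
  allNat fun x => arrow (atom (x < m)) (atom (val g x = 0))

/-- "`g` is eventually `0`". -/
def eventuallyZero (g : baire.El) : PER :=
  exNat fun N => allNat fun n => arrow (atom (N ≤ n)) (atom (val g n = 0))

/-- The set `A_F`, which consists of `0` and of all `m` for which some `g` that extends `0^m` and is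
eventually `0` has `F g ≠ F 0`. -/
def supportSet (F : functional.El) (m : ℕ) : PER :=
  or (atom (m = 0))
    (ex baire fun g => and (extendsZeros g m)
      (and (eventuallyZero g) (neg (atom (fval F g = fval F zeroFun)))))

end ExtReal

namespace ExtReal

/-! ### Indices of partial computable functions -/

open Nat.Partrec (Code)
open Encodable

/-! Countability of `A_F`: eventually zero sequences are coded by lists, so one runs through all
pairs `(m, l)`, tests `F` on the sequence coded by the pair, and lists `m` if the value differs from
`F 0`, and `0` otherwise.

Pseudo-boundedness rests on a weak continuity property (`exists_fval_eq_fval_zeroFun`): if a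
computable family `H n` vanishes below `n`, then `F (H n) = F 0` for some `n`. The recursion theorem
gives this through an index that stays `0` until `F` has visibly answered on it, and only then
copies some `H n`. Given a sequence `s` in `A_F` and `k`, call `n` bad if `n ≤ (k + 1) * s n`. The
witness for `s n ∈ A_F` is then `0` below `n / (k + 1)`, so a sequence can remain `0` while it looks
for a bad `n ≥ N` and still turn into that witness (`splice`). Once `F` takes the value `F 0` on it,
no bad `n ≥ N` exists, since a witness has a different `F`-value. The least success of this search
depends on `F`, `s` and the witnesses but not on their names.

A bound on `A_F` cannot be extensional in `F`: if `b` is the bound for the zero functional, a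
self-referential name of `F` makes `F` nonzero on some extension of `0^(b+1)` exactly when its own
computed bound is `b` (`not_realized_bounded`). Since realizers of BD-ℕ are uniform in the set, one
would yield such a bound. -/

theorem app_partrec : Partrec₂ app :=
  Code.eval_part.comp ((Computable.ofNat Code).comp Computable.fst) Computable.snd

/-- The parametrization theorem: indices can be computed from parameters. -/
theorem exists_computable_index {α : Type*} [Primcodable α] {f : α → ℕ →. ℕ} (hf : Partrec₂ f) :
    ∃ c : α → ℕ, Computable c ∧ ∀ a n, app (c a) n = f a n := by
  obtain ⟨d, hd⟩ := Code.exists_code.1 hf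
  refine ⟨fun a => encode (d.curry (encode a)), ?_, fun a n => ?_⟩
  · exact Computable.encode.comp
      (Code.primrec₂_curry.to_comp.comp (Computable.const d) Computable.encode)
  · rw [app, Denumerable.ofNat_encode, Code.eval_curry, hd]
    have : decode (α := α × ℕ) (Nat.pair (encode a) n) = some (a, n) := by
      simp
    simp only [this, Part.coe_some, Part.bind_some]
    exact Part.map_id' (fun _ => rfl) _

/-- A partial computable function has an index. -/
theorem exists_index {f : ℕ →. ℕ} (hf : Partrec f) : ∃ e, ∀ n, app e n = f n := by
  obtain ⟨c, -, hc⟩ := exists_computable_index (α := Unit) (f := fun _ n => f n)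
    (hf.comp Computable.snd)
  exact ⟨c (), hc ()⟩

/-- Because of this, `0` serves both as a name of the zero sequence and as a trivial realizer. -/
theorem app_zero (n : ℕ) : app 0 n = Part.some 0 := by
  have : Denumerable.ofNat Code 0 = Code.zero := Denumerable.ofNat_encode Code.zero
  rw [app, this]
  rfl

@[simp] theorem fst_pair (a b : ℕ) : fst (Nat.pair a b) = a := by simp [fst]

@[simp] theorem snd_pair (a b : ℕ) : snd (Nat.pair a b) = b := by simp [snd]

theorem computable_fst : Computable fst := Computable.fst.comp Computable.unpair

theorem computable_snd : Computable snd := Computable.snd.comp Computable.unpair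

theorem computable_pair : Computable₂ Nat.pair := Primrec₂.natPair.to_comp

/-! ### Names, elements and realizers -/

namespace PER

theorem baire_rel {e e' : ℕ} : baire.rel e e' ↔ ∃ f : ℕ → ℕ, ∀ n, f n ∈ app e n ∧ f n ∈ app e' n := by
  constructor
  · intro h
    have : ∀ n, ∃ u, u ∈ app e n ∧ u ∈ app e' n := fun n => by
      obtain ⟨u, hu, v, hv, rfl⟩ := h n n rfl
      exact ⟨u, hu, hv⟩
    choose f hf using this
    exact ⟨f, hf⟩
  · rintro ⟨f, hf⟩ a _ rfl
    exact ⟨f a, (hf a).1, f a, (hf a).2, rfl⟩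

theorem Names.rel {X : PER} {x : X.El} {a b : ℕ} (ha : Names x a) (hb : Names x b) :
    X.rel a b := by
  obtain ⟨h, rfl⟩ := ha
  obtain ⟨k, hk⟩ := hb
  exact X.symm _ _ (Quotient.exact (s := X.setoid) hk)

theorem Names.of_rel {X : PER} {x : X.El} {a b : ℕ} (ha : Names x a) (h : X.rel a b) :
    Names x b := by
  obtain ⟨k, rfl⟩ := ha
  exact ⟨X.trans _ _ _ (X.symm _ _ h) h, Quotient.sound (s := X.setoid) (X.symm _ _ h)⟩

theorem Names.unique {X : PER} {x y : X.El} {a : ℕ} (hx : Names x a) (hy : Names y a) : x = y := by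
  obtain ⟨h, rfl⟩ := hx
  obtain ⟨k, rfl⟩ := hy
  rfl

theorem exists_names {X : PER} (x : X.El) : ∃ a, Names x a := by
  induction x using Quotient.inductionOn with
  | h a => exact ⟨a.1, a.2, rfl⟩

theorem exists_named {X : PER} {a b : ℕ} (h : X.rel a b) : ∃ x : X.El, Names x a ∧ Names x b := by
  have ha : X.rel a a := X.trans _ _ _ h (X.symm _ _ h)
  have : Names (X.elem a ha) a := ⟨ha, rfl⟩
  exact ⟨_, this, this.of_rel h⟩

theorem names_nat {x : nat.El} {a : ℕ} : Names x a ↔ num x = a := by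
  induction x using Quotient.inductionOn with
  | h b =>
    constructor
    · rintro ⟨h, hx⟩
      exact (Quotient.exact (s := nat.setoid) hx).symm
    · rintro rfl
      exact ⟨rfl, rfl⟩

theorem Names.ev_mem {X Y : PER} {f : (arrow X Y).El} {x : X.El} {e a : ℕ} (hf : Names f e)
    (hx : Names x a) : ∃ u ∈ app e a, Names (ev f x) u := by
  obtain ⟨h, rfl⟩ := hf
  obtain ⟨k, rfl⟩ := hx
  have hd := app_dom h k
  exact ⟨(app e a).get hd, Part.get_mem hd, app_rel h k hd hd, rfl⟩

theorem names_lit (n : ℕ) : Names (lit n) n := ⟨rfl, rfl⟩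

theorem Names.app_eq {f : baire.El} {e : ℕ} (hf : Names f e) (n : ℕ) :
    app e n = Part.some (val f n) := by
  obtain ⟨u, hu, h⟩ := hf.ev_mem (names_lit n)
  rw [names_nat] at h
  rw [val, h]
  exact Part.eq_some_iff.2 hu

theorem Names.app_eq_fval {F : functional.El} {g : baire.El} {z e : ℕ} (hF : Names F z)
    (hg : Names g e) : app z e = Part.some (fval F g) := by
  obtain ⟨u, hu, h⟩ := hF.ev_mem hg
  rw [names_nat] at h
  rw [fval, h]
  exact Part.eq_some_iff.2 hu

theorem names_of_app_eq {f : baire.El} {e : ℕ} (h : ∀ n, app e n = Part.some (val f n)) :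
    Names f e := by
  obtain ⟨a, ha⟩ := exists_names f
  exact ha.of_rel (baire_rel.2 ⟨val f, fun n => ⟨by simp [ha.app_eq], by simp [h]⟩⟩)

theorem exists_named_of_app_eq {f : ℕ → ℕ} {e e' : ℕ} (h : ∀ n, app e n = Part.some (f n))
    (h' : ∀ n, app e' n = Part.some (f n)) :
    ∃ g : baire.El, val g = f ∧ Names g e ∧ Names g e' := by
  obtain ⟨g, hg, hg'⟩ := exists_named (X := baire) (a := e) (b := e')
    (baire_rel.2 ⟨f, fun n => by simp [h, h']⟩)
  refine ⟨g, funext fun n => Part.some_injective ?_, hg, hg'⟩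
  rw [← hg.app_eq, h]

theorem val_injective : Function.Injective val := by
  intro f g h
  obtain ⟨e, he⟩ := exists_names f
  exact he.unique (names_of_app_eq fun n => by rw [he.app_eq, h])

theorem names_zeroFun : Names zeroFun 0 := ⟨_, rfl⟩

theorem val_zeroFun (n : ℕ) : val zeroFun n = 0 :=
  Part.some_injective <| by rw [← names_zeroFun.app_eq, app_zero]

theorem functional_rel {z z' : ℕ}
    (h : ∀ g : baire.El, ∀ e e', Names g e → Names g e' → ∃ u, u ∈ app z e ∧ u ∈ app z' e') :
    functional.rel z z' := by
  intro a a' ha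
  obtain ⟨g, hg, hg'⟩ := exists_named ha
  obtain ⟨u, hu, hu'⟩ := h g a a' hg hg'
  exact ⟨u, hu, u, hu', rfl⟩

theorem allNat_rel {φ : ℕ → PER} {e e' : ℕ} :
    (allNat φ).rel e e' ↔ ∀ n, ∃ u ∈ app e n, ∃ v ∈ app e' n, (φ n).rel u v := by
  constructor
  · intro h n
    exact h (lit n) n n (names_lit n) (names_lit n)
  · intro h x a a' ha ha'
    rw [names_nat] at ha ha'
    subst ha
    subst ha'
    exact h _

/-- Names of numbers are unique, so equivalent realizers carry the same number. This forces bounds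
and moduli to be extensional. -/
theorem exNat_rel {φ : ℕ → PER} {e e' : ℕ} :
    (exNat φ).rel e e' ↔ fst e = fst e' ∧ (φ (fst e)).rel (snd e) (snd e') := by
  constructor
  · rintro ⟨x, h, h', k⟩
    rw [names_nat] at h h'
    exact ⟨h.symm.trans h', h ▸ k⟩
  · rintro ⟨h, k⟩
    exact ⟨lit (fst e), names_lit _, h ▸ names_lit _, k⟩

/-- `0` realizes every true statement of the form `∀ n, p n → q n` with prime `p` and `q`. -/
theorem allNat_atom_rel_zero {p q : ℕ → Prop} (h : ∀ n, p n → q n) :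
    (allNat fun n => arrow (atom (p n)) (atom (q n))).rel 0 0 :=
  allNat_rel.2 fun n => ⟨0, by simp [app_zero], 0, by simp [app_zero],
    fun a a' hp => ⟨0, by simp [app_zero], 0, by simp [app_zero], h n hp⟩⟩

theorem of_allNat_atom_rel {p q : ℕ → Prop} {e e' : ℕ}
    (h : (allNat fun n => arrow (atom (p n)) (atom (q n))).rel e e') (n : ℕ) (hp : p n) : q n := by
  obtain ⟨u, -, v, -, huv⟩ := allNat_rel.1 h n
  obtain ⟨_, -, _, -, hq⟩ := huv 0 0 hp
  exact hq

theorem neg_atom_rel {p : Prop} {e e' : ℕ} : (neg (atom p)).rel e e' ↔ ¬ p := by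
  constructor
  · intro h hp
    obtain ⟨_, -, _, -, hq⟩ := h 0 0 hp
    exact absurd hq zero_ne_one
  · intro h a a' hp
    exact absurd hp h

/-- An empty PER makes the condition on realizers of the implication vacuous. -/
theorem realized_neg {P : PER} (h : ¬ Realized P) : Realized (neg P) :=
  ⟨0, fun a _ ha => absurd ⟨a, P.trans _ _ _ ha (P.symm _ _ ha)⟩ h⟩

end PER

/-! ### Countability of `A_F` -/

/-- The sequence that is `0` below `p.1` and agrees with the list `p.2` from there on. -/
def extend (p : ℕ × List ℕ) (x : ℕ) : ℕ :=
  if x < p.1 then 0 else p.2.getD x 0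

theorem computable_extend : Computable₂ extend := by
  have : Primrec₂ extend :=
    Primrec.ite (Primrec.nat_lt.comp Primrec.snd (Primrec.fst.comp Primrec.fst)) (Primrec.const 0)
      ((Primrec.list_getD 0).comp (Primrec.snd.comp Primrec.fst) Primrec.snd)
  exact this.to_comp

theorem extend_of_length_le {p : ℕ × List ℕ} {x : ℕ} (h : p.2.length ≤ x) : extend p x = 0 := by
  rw [extend, List.getD_eq_default _ _ h, ite_self]

theorem exists_extend_index :
    ∃ c : ℕ × List ℕ → ℕ, Computable c ∧ ∀ p x, app (c p) x = Part.some (extend p x) :=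
  exists_computable_index (f := fun p x => Part.some (extend p x)) computable_extend.partrec

/-- The list of the first `n` values of the function with index `e`. -/
def initialValues (e n : ℕ) : Part (List ℕ) :=
  n.rec (Part.some []) fun i l => l.bind fun l => (app e i).map fun v => l ++ [v]

theorem partrec_initialValues : Partrec₂ initialValues := by
  refine Partrec.nat_rec (α := ℕ × ℕ) (σ := List ℕ) (f := fun p => p.2)
    (g := fun _ => Part.some []) (h := fun p q => (app p.1 q.1).map fun v => q.2 ++ [v])
    Computable.snd (Computable.const []) ?_
  refine Partrec.map (app_partrec.comp (Computable.fst.comp Computable.fst)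
    (Computable.fst.comp Computable.snd)) ?_
  exact Computable.list_concat.comp
    (Computable.snd.comp (Computable.snd.comp Computable.fst)) Computable.snd

theorem initialValues_eq {e : ℕ} {f : ℕ → ℕ} (h : ∀ n, app e n = Part.some (f n)) (n : ℕ) :
    initialValues e n = Part.some ((List.range n).map f) := by
  induction n with
  | zero => rfl
  | succ n ih =>
    rw [initialValues] at ih ⊢
    dsimp only
    rw [ih, Part.bind_some, h, Part.map_some, List.range_succ, List.map_append, List.map_singleton]

theorem getD_map_range (f : ℕ → ℕ) (n x : ℕ) :
    ((List.range n).map f).getD x 0 = if x < n then f x else 0 := by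
  by_cases h : x < n <;> simp [List.getD, h]

namespace PER

/-- The name of the sequence in a realizer of `m ∈ A_F` with tag `1`. -/
def witness (e : ℕ) : ℕ := fst (snd e)

/-- The bound on the support in a realizer of `m ∈ A_F` with tag `1`. -/
def witnessBound (e : ℕ) : ℕ := fst (fst (snd (snd (snd e))))

theorem computable_witness : Computable witness := computable_fst.comp computable_snd

theorem computable_witnessBound : Computable witnessBound :=
  computable_fst.comp <| computable_fst.comp <|
    computable_snd.comp <| computable_snd.comp computable_snd

/-- Equivalent realizers share the tag, the element `g` and the support bound; only the name of `g`
may vary. -/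
theorem supportSet_rel_cases {F : functional.El} {m e e' : ℕ} (h : (supportSet F m).rel e e') :
    (fst e = 0 ∧ fst e' = 0 ∧ m = 0) ∨ (fst e = 1 ∧ fst e' = 1 ∧ ∃ g : baire.El,
      Names g (witness e) ∧ Names g (witness e') ∧ (∀ x < m, val g x = 0) ∧
      witnessBound e = witnessBound e' ∧ (∀ n, witnessBound e ≤ n → val g n = 0) ∧
      fval F g ≠ fval F zeroFun) := by
  rcases h with ⟨h, h', k⟩ | ⟨h, h', g, hg, hg', h1, h2, h3⟩
  · exact Or.inl ⟨h, h', k⟩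
  · obtain ⟨h2, h4⟩ := exNat_rel.1 h2
    exact Or.inr ⟨h, h', g, hg, hg', of_allNat_atom_rel h1, h2, of_allNat_atom_rel h4,
      neg_atom_rel.1 h3⟩

theorem supportSet_rel_zero (F : functional.El) :
    (supportSet F 0).rel (Nat.pair 0 0) (Nat.pair 0 0) :=
  Or.inl ⟨fst_pair _ _, fst_pair _ _, rfl⟩

theorem supportSet_rel_one {F : functional.El} {g : baire.El} {m n e e' : ℕ} (he : Names g e)
    (he' : Names g e') (hm : ∀ x < m, val g x = 0) (hn : ∀ x, n ≤ x → val g x = 0)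
    (hF : fval F g ≠ fval F zeroFun) :
    (supportSet F m).rel (Nat.pair 1 (Nat.pair e (Nat.pair 0 (Nat.pair (Nat.pair n 0) 0))))
      (Nat.pair 1 (Nat.pair e' (Nat.pair 0 (Nat.pair (Nat.pair n 0) 0)))) := by
  refine Or.inr ⟨fst_pair _ _, fst_pair _ _, g, ?_, ?_, ?_, ?_, ?_⟩
  · simpa using he
  · simpa using he'
  · simp only [fst_pair, snd_pair]
    exact allNat_atom_rel_zero hm
  · simp only [snd_pair, fst_pair]
    exact exNat_rel.2 ⟨rfl, by simpa using allNat_atom_rel_zero hn⟩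
  · exact neg_atom_rel.2 hF

/-- Countability of `A_F` has a realizer that is computable from a name of `F`, extensionally. -/
theorem exists_countable_supportSet_index : ∃ c : ℕ → ℕ, Computable c ∧
    ∀ (F : functional.El) (z z' : ℕ), Names F z → Names F z' →
      (countable (supportSet F)).rel (c z) (c z') := by
  obtain ⟨d, hd, happ⟩ := exists_extend_index
  -- The enumeration. The default value `0` is harmless because `0` always belongs to `A_F`.
  obtain ⟨a, ha, ha'⟩ := exists_computable_index (α := ℕ)
    (f := fun z k => (app z (d (Denumerable.ofNat (ℕ × List ℕ) k))).bind fun u =>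
      (app z 0).map fun v => if u = v then 0 else (Denumerable.ofNat (ℕ × List ℕ) k).1) (by
    have hk := (Computable.ofNat (ℕ × List ℕ)).comp (Computable.snd (α := ℕ) (β := ℕ))
    refine Partrec.bind (app_partrec.comp Computable.fst (hd.comp hk)) ?_
    refine Partrec.map (app_partrec.comp (Computable.fst.comp Computable.fst)
      (Computable.const 0)) ?_
    have : Primrec fun q : ((ℕ × ℕ) × ℕ) × ℕ =>
        if q.1.2 = q.2 then 0 else (Denumerable.ofNat (ℕ × List ℕ) q.1.1.2).1 :=
      Primrec.ite (Primrec.eq.comp (Primrec.snd.comp Primrec.fst) Primrec.snd) (Primrec.const 0)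
        (Primrec.fst.comp <| (Primrec.ofNat (ℕ × List ℕ)).comp <|
          Primrec.snd.comp <| Primrec.fst.comp Primrec.fst)
    exact this.to_comp)
  -- From membership to a position: tabulate the witness up to its support bound. The table depends
  -- on the values of the witness, not on its name. For tag `0` the empty table is used.
  obtain ⟨b, hb, hb'⟩ := exists_computable_index (α := ℕ)
    (f := fun m e => (initialValues (witness e) (if fst e = 0 then 0 else witnessBound e)).map
      fun l => Nat.pair (encode (m, l)) 0) (by
    refine Partrec.map (partrec_initialValues.comp (computable_witness.comp Computable.snd) ?_) ?_
    · have : Computable fun e => bif decide (fst e = 0) then 0 else witnessBound e :=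
        Computable.cond ((Primrec.eq.comp Primrec.id (Primrec.const 0)).decide.to_comp.comp
          computable_fst) (Computable.const 0) computable_witnessBound
      refine (this.comp Computable.snd).of_eq fun p => ?_
      by_cases h : fst p.2 = 0 <;> simp [h]
    · exact computable_pair.comp (Computable.encode.comp
        ((Computable.fst.comp Computable.fst).pair Computable.snd)) (Computable.const 0))
  -- From a position to membership: for `m ≠ 0` the list at that position supplies the witness, and
  -- its length bounds the support.
  obtain ⟨b₁, hb₁, hb₁'⟩ := exists_computable_index (α := ℕ)
    (f := fun m e => Part.some (if m = 0 then Nat.pair 0 0 else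
      Nat.pair 1 (Nat.pair (d (Denumerable.ofNat (ℕ × List ℕ) (fst e)))
        (Nat.pair 0 (Nat.pair
          (Nat.pair (Denumerable.ofNat (ℕ × List ℕ) (fst e)).2.length 0) 0))))) (by
    have hk := (Computable.ofNat (ℕ × List ℕ)).comp
      (computable_fst.comp (Computable.snd (α := ℕ) (β := ℕ)))
    have := Computable.cond (c := fun p : ℕ × ℕ => decide (p.1 = 0))
      (Primrec.eq.comp Primrec.fst (Primrec.const 0)).decide.to_comp
      (Computable.const (Nat.pair 0 0))
      (computable_pair.comp (Computable.const 1) (computable_pair.comp (hd.comp hk)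
        (computable_pair.comp (Computable.const 0) (computable_pair.comp (computable_pair.comp
          (Computable.list_length.comp (Computable.snd.comp hk)) (Computable.const 0))
          (Computable.const 0)))))
    refine Computable.partrec (this.of_eq fun p => ?_)
    by_cases h : p.1 = 0 <;> simp [h])
  obtain ⟨i, hi⟩ := exists_index (f := fun m => Part.some (Nat.pair (b m) (b₁ m)))
    (computable_pair.comp hb hb₁).partrec
  refine ⟨fun z => Nat.pair (a z) i, computable_pair.comp ha (Computable.const i),
    fun F z z' hz hz' => ?_⟩
  have key : ∀ p : ℕ × List ℕ, ∃ g : baire.El, val g = extend p ∧ Names g (d p) := fun p => by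
    obtain ⟨g, h1, h2, -⟩ := exists_named_of_app_eq (happ p) (happ p)
    exact ⟨g, h1, h2⟩
  choose γ hγ hγ' using key
  set f : ℕ → ℕ := fun k =>
    if fval F (γ (Denumerable.ofNat (ℕ × List ℕ) k)) = fval F zeroFun then 0
    else (Denumerable.ofNat (ℕ × List ℕ) k).1 with hf
  have haf : ∀ y, Names F y → ∀ k, app (a y) k = Part.some (f k) := fun y hy k => by
    simp only [ha', hy.app_eq_fval (hγ' _), hy.app_eq_fval names_zeroFun, Part.bind_some,
      Part.map_some, hf]
  obtain ⟨α, hα, hαz, hαz'⟩ := exists_named_of_app_eq (haf z hz) (haf z' hz')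
  refine ⟨α, by simpa using hαz, by simpa using hαz', ?_⟩
  simp only [snd_pair]
  refine allNat_rel.2 fun m => ⟨_, by rw [hi]; exact Part.mem_some _, _,
    by rw [hi]; exact Part.mem_some _, ?_, ?_⟩
  · simp only [fst_pair]
    intro e e' he
    suffices h : ∃ l, initialValues (witness e) (if fst e = 0 then 0 else witnessBound e) =
        Part.some l ∧ initialValues (witness e') (if fst e' = 0 then 0 else witnessBound e') =
        Part.some l ∧ f (encode (m, l)) = m by
      obtain ⟨l, h1, h2, h3⟩ := h
      refine ⟨Nat.pair (encode (m, l)) 0, by simp [hb', h1], Nat.pair (encode (m, l)) 0,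
        by simp [hb', h2], exNat_rel.2 ⟨rfl, ?_⟩⟩
      rw [fst_pair, hα]
      exact h3
    rcases supportSet_rel_cases he with ⟨h, h', rfl⟩ | ⟨h, h', g, hg, hg', hm, hw, hn, hF⟩
    · exact ⟨[], by simp [h, initialValues], by simp [h', initialValues], by simp [hf]⟩
    · refine ⟨_, by simpa [h] using initialValues_eq hg.app_eq _,
        by simpa [h', hw] using initialValues_eq hg'.app_eq _, ?_⟩
      -- Since `g` vanishes below `m` and from the bound on, its table recovers it completely.
      have : γ (m, (List.range (witnessBound e)).map (val g)) = g := by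
        refine val_injective ?_
        rw [hγ]
        funext x
        rw [extend]
        dsimp only
        rw [getD_map_range]
        split_ifs with h1 h2
        · exact (hm x h1).symm
        · rfl
        · exact (hn x (not_lt.1 h2)).symm
      simp [hf, this, hF]
  · simp only [snd_pair]
    intro e e' he
    obtain ⟨h1, h2⟩ := exNat_rel.1 he
    refine ⟨_, by rw [hb₁']; exact Part.mem_some _, _, by rw [hb₁']; exact Part.mem_some _, ?_⟩
    rw [← h1]
    change val α (fst e) = m at h2
    rw [hα] at h2
    by_cases hm : m = 0
    · subst hm
      simpa using supportSet_rel_zero F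
    · simp only [hf] at h2
      split_ifs at h2 with hF
      · exact absurd h2.symm hm
      · rw [if_neg hm]
        refine supportSet_rel_one (hγ' _) (hγ' _) (fun x hx => ?_) (fun x hx => ?_) hF
        · rw [hγ, extend, if_pos (h2 ▸ hx)]
        · rw [hγ, extend_of_length_le hx]

end PER

/-! ### Continuity at the zero sequence -/

/-- Whether the code `p.2.1` halts on `p.2.2.1` with value `p.2.2.2` within `p.1` steps. -/
def haltsWith (p : ℕ × ℕ × ℕ × ℕ) : Bool :=
  decide (Code.evaln p.1 (Denumerable.ofNat Code p.2.1) p.2.2.1 = some p.2.2.2)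

theorem computable_haltsWith : Computable haltsWith := by
  have h : Primrec fun p : ℕ × ℕ × ℕ × ℕ =>
      Code.evaln p.1 (Denumerable.ofNat Code p.2.1) p.2.2.1 :=
    Code.primrec_evaln.comp ((Primrec.fst.pair
      ((Primrec.ofNat Code).comp (Primrec.fst.comp Primrec.snd))).pair
      (Primrec.fst.comp (Primrec.snd.comp Primrec.snd)))
  exact (Primrec.eq.comp h (Primrec.option_some.comp
    (Primrec.snd.comp (Primrec.snd.comp Primrec.snd)))).decide.to_comp

theorem mem_app_of_haltsWith {t e n v : ℕ} (h : haltsWith (t, e, n, v) = true) : v ∈ app e n :=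
  Code.evaln_sound (Option.mem_def.2 (of_decide_eq_true h))

theorem exists_haltsWith {e n v : ℕ} (h : v ∈ app e n) : ∃ t, haltsWith (t, e, n, v) = true := by
  obtain ⟨t, ht⟩ := Code.evaln_complete.1 h
  exact ⟨t, decide_eq_true ht⟩

/-- Kleene's second recursion theorem for indices. -/
theorem exists_fixed_index {f : ℕ → ℕ →. ℕ} (hf : Partrec₂ f) : ∃ e, ∀ n, app e n = f e n := by
  obtain ⟨c, hc⟩ := Code.fixed_point₂ (f := fun c => f (encode c))
    (hf.comp (Computable.encode.comp Computable.fst) Computable.snd)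
  exact ⟨encode c, fun n => by rw [app, Denumerable.ofNat_encode, hc]⟩

namespace PER

/-- Functionals are continuous at `0` along computable sequences that converge to `0` with a
known modulus. -/
theorem exists_fval_eq_fval_zeroFun (F : functional.El) {H : ℕ → baire.El} {c : ℕ → ℕ}
    (hc : Computable c) (hH : ∀ n, Names (H n) (c n)) (h0 : ∀ n x, x < n → val (H n) x = 0) :
    ∃ n, fval F (H n) = fval F zeroFun := by
  obtain ⟨z, hz⟩ := exists_names F
  set v := fval F zeroFun with hv
  -- On input `x`, the index `e` watches the run of `z` on `e` itself for up to `x` steps. Without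
  -- an answer `v` it returns `0`; if the answer appears at stage `t`, it copies `H (t + 1)`.
  obtain ⟨e, he⟩ := exists_fixed_index (f := fun e x =>
    (Nat.rfind fun t => Part.some (decide (x ≤ t) || haltsWith (t, z, e, v))).bind fun t =>
      app (bif haltsWith (t, z, e, v) then c (t + 1) else 0) x) (by
    refine Partrec.bind (Partrec.rfind (Computable.partrec ?_)) ?_
    · have h1 : Computable fun p : (ℕ × ℕ) × ℕ => decide (p.1.2 ≤ p.2) :=
        (Primrec.nat_le.comp (Primrec.snd.comp Primrec.fst) Primrec.snd).decide.to_comp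
      have h2 : Computable fun p : (ℕ × ℕ) × ℕ => haltsWith (p.2, z, p.1.1, v) :=
        computable_haltsWith.comp (Computable.snd.pair ((Computable.const z).pair
          ((Computable.fst.comp Computable.fst).pair (Computable.const v))))
      exact Primrec.or.to_comp.comp h1 h2
    · refine app_partrec.comp (Computable.cond ?_ ?_ (Computable.const 0))
        (Computable.snd.comp Computable.fst)
      · exact computable_haltsWith.comp (Computable.snd.pair ((Computable.const z).pair
          ((Computable.fst.comp Computable.fst).pair (Computable.const v))))
      · exact hc.comp (Computable.succ.comp Computable.snd))
  have eval_of : ∀ x t, (x ≤ t ∨ haltsWith (t, z, e, v) = true) →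
      (∀ m < t, m < x ∧ haltsWith (m, z, e, v) = false) →
      app e x = app (bif haltsWith (t, z, e, v) then c (t + 1) else 0) x := fun x t h1 h2 => by
    have : Nat.rfind (fun t => Part.some (decide (x ≤ t) || haltsWith (t, z, e, v))) =
        Part.some t := by
      refine Part.eq_some_iff.2 (Nat.mem_rfind.2 ⟨?_, fun {m} hm => ?_⟩)
      · refine Part.mem_some_iff.2 (Eq.symm ?_)
        simpa using h1
      · refine Part.mem_some_iff.2 (Eq.symm ?_)
        simpa using h2 m hm
    rw [he, this, Part.bind_some]
  by_cases hex : ∃ t, haltsWith (t, z, e, v) = true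
  · classical
    set T := Nat.find hex with hT
    have h1 : haltsWith (T, z, e, v) = true := Nat.find_spec hex
    have h2 : ∀ m < T, haltsWith (m, z, e, v) = false := fun m hm =>
      Bool.eq_false_iff.2 (Nat.find_min hex hm)
    refine ⟨T + 1, ?_⟩
    -- The zeros already produced below `T` agree with `H (T + 1)`, so `e` names this element and
    -- the observed answer `v` is its `F`-value.
    have hn : Names (H (T + 1)) e := names_of_app_eq fun x => by
      rcases lt_or_ge x T with hx | hx
      · rw [eval_of x x (Or.inl le_rfl) fun m hm => ⟨hm, h2 m (hm.trans hx)⟩, h2 x hx,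
          h0 _ _ (hx.trans (Nat.lt_succ_self _))]
        exact app_zero x
      · rw [eval_of x T (Or.inr h1) fun m hm => ⟨hm.trans_le hx, h2 m hm⟩, h1]
        exact (hH _).app_eq x
    have := mem_app_of_haltsWith h1
    rw [hz.app_eq_fval hn] at this
    exact (Part.mem_some_iff.1 this).symm
  · have hex : ∀ t, haltsWith (t, z, e, v) = false := by simpa using hex
    -- Without an answer, `e` names the zero sequence; but then `z` must answer `v` on it.
    have hn : Names zeroFun e := names_of_app_eq fun x => by
      rw [eval_of x x (Or.inl le_rfl) fun m hm => ⟨hm, hex m⟩, hex, val_zeroFun]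
      exact app_zero x
    obtain ⟨t, ht⟩ := exists_haltsWith (e := z) (n := e) (v := v)
      (by rw [hz.app_eq_fval hn]; exact Part.mem_some _)
    exact absurd ht (by simp [hex t])

/-! ### Pseudo-boundedness of `A_F` -/

open Classical in
/-- The sequence that waits for the first `n ≥ N` with `n ≤ (k + 1) * s n` and then, from
`n / (k + 1)` on, copies the sequence `γ n`. -/
noncomputable def splice (s : ℕ → ℕ) (γ : ℕ → ℕ → ℕ) (k N x : ℕ) : ℕ :=
  if h : ∃ n, N ≤ n ∧ n ≤ (k + 1) * x ∧ n ≤ (k + 1) * s n then γ (Nat.find h) x else 0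

theorem splice_eq_zero {s : ℕ → ℕ} {γ : ℕ → ℕ → ℕ} {k N x : ℕ} (h : (k + 1) * x < N) :
    splice s γ k N x = 0 :=
  dif_neg fun ⟨_, h1, h2, _⟩ => by omega

/-- Let `n` be the first bad index. Where `n ≤ (k + 1) * x`, the search finds exactly `n`; where `(k
+ 1) * x < n`, badness gives `x < s n`, so `γ n` vanishes there too. -/
theorem splice_eq {s : ℕ → ℕ} {γ : ℕ → ℕ → ℕ} {k N : ℕ}
    (hγ : ∀ n, N ≤ n → n ≤ (k + 1) * s n → ∀ x < s n, γ n x = 0)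
    (h : ∃ n, N ≤ n ∧ n ≤ (k + 1) * s n) :
    ∃ n, N ≤ n ∧ n ≤ (k + 1) * s n ∧ splice s γ k N = γ n := by
  classical
  obtain ⟨h1, h2⟩ := Nat.find_spec h
  refine ⟨Nat.find h, h1, h2, funext fun x => ?_⟩
  rw [splice]
  split_ifs with hx
  · congr 1
    obtain ⟨g1, g2, g3⟩ := Nat.find_spec hx
    refine le_antisymm ((Nat.find_le_iff hx _).2 ⟨_, le_rfl, h1, ?_, h2⟩)
      ((Nat.find_le_iff h _).2 ⟨_, le_rfl, g1, g3⟩)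
    exact ((Nat.find_le_iff h _).2 ⟨_, le_rfl, g1, g3⟩).trans g2
  · have : (k + 1) * x < Nat.find h := not_le.1 fun h3 => hx ⟨_, h1, h3, h2⟩
    exact (hγ _ h1 h2 x (Nat.lt_of_mul_lt_mul_left (this.trans_le h2))).symm

/-- The sequence `splice s γ k N` is computable from the sequence `s` and witnesses for `γ`. -/
theorem exists_splice_index : ∃ d : ℕ × ℕ × ℕ × ℕ → ℕ, Computable d ∧
    ∀ (e r k N : ℕ) (s : ℕ → ℕ) (γ : ℕ → ℕ → ℕ), (∀ n, app e n = Part.some (s n)) →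
      (∀ n, ∃ u ∈ app r n, N ≤ n → n ≤ (k + 1) * s n →
        ∀ x, app (witness u) x = Part.some (γ n x)) →
      ∀ x, app (d (e, r, k, N)) x = Part.some (splice s γ k N x) := by
  -- The search runs over `n = N + j` and must stop: either `n` is bad or `n` passes `(k + 1) * x`.
  -- In the latter case the index `0` yields the value `0`.
  obtain ⟨d, hd, hd'⟩ := exists_computable_index (α := ℕ × ℕ × ℕ × ℕ) (f := fun q x =>
    (Nat.rfind fun j => (app q.1 (q.2.2.2 + j)).map fun v =>
      decide ((q.2.2.1 + 1) * x < q.2.2.2 + j ∨ q.2.2.2 + j ≤ (q.2.2.1 + 1) * v)).bind fun j =>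
    (app q.2.1 (q.2.2.2 + j)).bind fun u =>
      app (bif decide ((q.2.2.1 + 1) * x < q.2.2.2 + j) then 0 else witness u) x) (by
    have hj : Primrec fun p : ((ℕ × ℕ × ℕ × ℕ) × ℕ) × ℕ => p.1.1.2.2.2 + p.2 :=
      Primrec.nat_add.comp (Primrec.snd.comp <| Primrec.snd.comp <| Primrec.snd.comp <|
        Primrec.fst.comp Primrec.fst) Primrec.snd
    have hk : Primrec fun p : ((ℕ × ℕ × ℕ × ℕ) × ℕ) × ℕ => p.1.1.2.2.1 + 1 :=
      Primrec.succ.comp (Primrec.fst.comp <| Primrec.snd.comp <| Primrec.snd.comp <|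
        Primrec.fst.comp Primrec.fst)
    have hlt : PrimrecPred fun p : ((ℕ × ℕ × ℕ × ℕ) × ℕ) × ℕ =>
        (p.1.1.2.2.1 + 1) * p.1.2 < p.1.1.2.2.2 + p.2 :=
      Primrec.nat_lt.comp (Primrec.nat_mul.comp hk (Primrec.snd.comp Primrec.fst)) hj
    refine Partrec.bind (Partrec.rfind (Partrec.map (app_partrec.comp
      (Computable.fst.comp (Computable.fst.comp Computable.fst)) hj.to_comp) ?_)) ?_
    · have : PrimrecPred fun p : (((ℕ × ℕ × ℕ × ℕ) × ℕ) × ℕ) × ℕ =>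
          (p.1.1.1.2.2.1 + 1) * p.1.1.2 < p.1.1.1.2.2.2 + p.1.2 ∨
            p.1.1.1.2.2.2 + p.1.2 ≤ (p.1.1.1.2.2.1 + 1) * p.2 :=
        (hlt.comp Primrec.fst).or (Primrec.nat_le.comp (hj.comp Primrec.fst)
          (Primrec.nat_mul.comp (hk.comp Primrec.fst) Primrec.snd))
      exact this.decide.to_comp
    · refine Partrec.bind (app_partrec.comp (Computable.fst.comp <| Computable.snd.comp <|
        Computable.fst.comp Computable.fst) hj.to_comp) ?_
      refine app_partrec.comp (Computable.cond (hlt.decide.to_comp.comp Computable.fst)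
        (Computable.const 0) (computable_witness.comp Computable.snd))
        (Computable.snd.comp (Computable.fst.comp Computable.fst)))
  refine ⟨d, hd, fun e r k N s γ hs hr x => ?_⟩
  have step : ∀ j, ((k + 1) * x < N + j ∨ N + j ≤ (k + 1) * s (N + j)) →
      (∀ m < j, N + m ≤ (k + 1) * x ∧ (k + 1) * s (N + m) < N + m) →
      app (d (e, r, k, N)) x = (app r (N + j)).bind fun u =>
        app (bif decide ((k + 1) * x < N + j) then 0 else witness u) x := fun j h1 h2 => by
    have : (Nat.rfind fun j => (app e (N + j)).map fun v =>
        decide ((k + 1) * x < N + j ∨ N + j ≤ (k + 1) * v)) = Part.some j := by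
      refine Part.eq_some_iff.2 (Nat.mem_rfind.2 ⟨?_, fun {m} hm => ?_⟩)
      · rw [hs, Part.map_some, decide_eq_true h1]
        exact Part.mem_some _
      · have := h2 m hm
        rw [hs, Part.map_some, decide_eq_false (by omega)]
        exact Part.mem_some _
    rw [hd']
    dsimp only
    rw [this, Part.bind_some]
  classical
  rw [splice]
  split_ifs with h
  · obtain ⟨h1, h2, h3⟩ := Nat.find_spec h
    have hN : N + (Nat.find h - N) = Nat.find h := by omega
    rw [step (Nat.find h - N) (by rw [hN]; exact Or.inr h3), hN]
    · obtain ⟨u, hu, hux⟩ := hr (Nat.find h)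
      rw [Part.eq_some_iff.2 hu, Part.bind_some, decide_eq_false (not_lt.2 h2)]
      exact hux h1 h3 x
    · intro m hm
      have h4 : N + m < Nat.find h := by omega
      have h5 : N + m ≤ (k + 1) * x := h4.le.trans h2
      exact ⟨h5, not_le.1 fun h6 => Nat.find_min h h4 ⟨by omega, h5, h6⟩⟩
  · rw [step ((k + 1) * x + 1 - N) (Or.inl (by omega)), decide_eq_true (by omega)]
    -- The realizer is run even after a failed search, so it has to be defined there; its result is
    -- discarded.
    · obtain ⟨u, hu, -⟩ := hr (N + ((k + 1) * x + 1 - N))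
      rw [Part.eq_some_iff.2 hu, Part.bind_some]
      exact app_zero x
    · intro m hm
      have h5 : N + m ≤ (k + 1) * x := by omega
      exact ⟨h5, not_le.1 fun h6 => h ⟨N + m, by omega, h5, h6⟩⟩

/-- Pseudo-boundedness of `A_F` has a realizer that is computable from a name of `F`,
extensionally. -/
theorem exists_pseudoBounded_supportSet_index : ∃ c : ℕ → ℕ, Computable c ∧
    ∀ (F : functional.El) (z z' : ℕ), Names F z → Names F z' →
      (pseudoBounded (supportSet F)).rel (c z) (c z') := by
  obtain ⟨d, hd, hsplice⟩ := exists_splice_index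
  obtain ⟨c₃, hc₃, happ₃⟩ := exists_computable_index (α := ℕ × ℕ × ℕ) (f := fun q k =>
    (Nat.rfind fun N => (app q.1 (d (q.2.1, q.2.2, k, N + 1))).bind fun u =>
      (app q.1 0).map fun v => decide (u = v)).map fun N => Nat.pair (N + 1) 0) (by
    refine Partrec.map (Partrec.rfind (Partrec.bind (app_partrec.comp
      (Computable.fst.comp (Computable.fst.comp Computable.fst)) (hd.comp ?_))
      (Partrec.map (app_partrec.comp (Computable.fst.comp <| Computable.fst.comp <|
        Computable.fst.comp Computable.fst) (Computable.const 0)) ?_))) ?_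
    · exact (Computable.fst.comp <| Computable.snd.comp <| Computable.fst.comp
        Computable.fst).pair <| (Computable.snd.comp <| Computable.snd.comp <|
        Computable.fst.comp Computable.fst).pair <| (Computable.snd.comp Computable.fst).pair <|
        Computable.succ.comp Computable.snd
    · exact (Primrec.eq.comp (Primrec.snd.comp Primrec.fst) Primrec.snd).decide.to_comp
    · exact computable_pair.comp (Computable.succ.comp Computable.snd) (Computable.const 0))
  obtain ⟨c₂, hc₂, happ₂⟩ := exists_computable_index (α := ℕ × ℕ)
    (f := fun q r => Part.some (c₃ (q.1, q.2, r)))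
    (hc₃.comp ((Computable.fst.comp Computable.fst).pair
      ((Computable.snd.comp Computable.fst).pair Computable.snd))).partrec
  obtain ⟨c₁, hc₁, happ₁⟩ := exists_computable_index (α := ℕ)
    (f := fun z s => Part.some (c₂ (z, s))) hc₂.partrec
  refine ⟨c₁, hc₁, fun F z z' hz hz' s e e' he he' => ?_⟩
  refine ⟨c₂ (z, e), by simp [happ₁], c₂ (z', e'), by simp [happ₁], fun r r' hr => ?_⟩
  refine ⟨c₃ (z, e, r), by simp [happ₂], c₃ (z', e', r'), by simp [happ₂], ?_⟩
  refine allNat_rel.2 fun k => ?_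
  -- A bad `n > 0` has `s n ≠ 0`, which excludes tag `0` and provides a genuine witness. Positivity
  -- is why all thresholds are `N + 1`.
  have hwit : ∀ n, ∃ u ∈ app r n, ∃ u' ∈ app r' n, ∃ g : baire.El,
      0 < n → n ≤ (k + 1) * val s n → Names g (witness u) ∧ Names g (witness u') ∧
        (∀ x < val s n, val g x = 0) ∧ fval F g ≠ fval F zeroFun := fun n => by
    obtain ⟨u, hu, u', hu', h⟩ := allNat_rel.1 hr n
    refine ⟨u, hu, u', hu', ?_⟩
    rcases supportSet_rel_cases h with ⟨-, -, h0⟩ | ⟨-, -, g, hg, hg', hm, -, -, hF⟩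
    · exact ⟨zeroFun, fun h1 h2 => by rw [h0] at h2; omega⟩
    · exact ⟨g, fun _ _ => ⟨hg, hg', hm, hF⟩⟩
  choose u hu u' hu' γ hγ using hwit
  have hex : ∀ N, ∃ H : baire.El, val H = splice (val s) (fun n => val (γ n)) k (N + 1) ∧
      Names H (d (e, r, k, N + 1)) ∧ Names H (d (e', r', k, N + 1)) := fun N =>
    exists_named_of_app_eq
      (hsplice _ _ _ _ _ _ he.app_eq fun n => ⟨u n, hu n, fun h1 h2 =>
        (hγ n (by omega) h2).1.app_eq⟩)
      (hsplice _ _ _ _ _ _ he'.app_eq fun n => ⟨u' n, hu' n, fun h1 h2 =>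
        (hγ n (by omega) h2).2.1.app_eq⟩)
  choose H hH hHd hHd' using hex
  have hcont : ∃ N, fval F (H N) = fval F zeroFun := by
    -- The factor `k + 1` makes the `n`-th member of the family vanish below `n`.
    obtain ⟨n, hn⟩ := exists_fval_eq_fval_zeroFun F (H := fun n => H ((k + 1) * n))
      (c := fun n => d (e, r, k, (k + 1) * n + 1))
      (hd.comp ((Computable.const e).pair ((Computable.const r).pair ((Computable.const k).pair
        (Primrec.succ.comp (Primrec.nat_mul.comp (Primrec.const (k + 1))
          Primrec.id)).to_comp))))
      (fun n => hHd _) (fun n x hx => by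
        rw [hH]
        exact splice_eq_zero (Nat.lt_succ_of_le (Nat.mul_le_mul_left _ hx.le)))
    exact ⟨_, hn⟩
  classical
  -- The least `N` with `F (H N) = F 0` mentions only elements, which makes the computed threshold
  -- extensional.
  have happ : ∀ y, Names F y → ∀ i q, (∀ N, Names (H N) (d (i, q, k, N + 1))) →
      app (c₃ (y, i, q)) k = Part.some (Nat.pair (Nat.find hcont + 1) 0) :=
    fun y hy i q hN => by
      have : (Nat.rfind fun N => (app y (d (i, q, k, N + 1))).bind fun u =>
          (app y 0).map fun v => decide (u = v)) = Part.some (Nat.find hcont) := by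
        simp only [hy.app_eq_fval (hN _), hy.app_eq_fval names_zeroFun, Part.bind_some,
          Part.map_some]
        refine Part.eq_some_iff.2 (Nat.mem_rfind.2 ⟨?_, fun {m} hm => ?_⟩)
        · rw [decide_eq_true (Nat.find_spec hcont)]
          exact Part.mem_some _
        · rw [decide_eq_false (Nat.find_min hcont hm)]
          exact Part.mem_some _
      rw [happ₃]
      dsimp only
      rw [this, Part.map_some]
  refine ⟨_, by rw [happ z hz e r hHd]; exact Part.mem_some _, _,
    by rw [happ z' hz' e' r' hHd']; exact Part.mem_some _, exNat_rel.2 ⟨rfl, ?_⟩⟩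
  rw [fst_pair, snd_pair]
  refine allNat_atom_rel_zero fun n hn => not_le.1 fun hbad => ?_
  -- A bad index past the threshold would turn `H N` into a witness `γ m`, whose `F`-value differs
  -- from `F 0`.
  obtain ⟨m, h1, h2, h3⟩ := splice_eq (γ := fun n => val (γ n))
    (fun n h1 h2 => (hγ n (by omega) h2).2.2.1) ⟨n, hn, hbad⟩
  refine (hγ m (by omega) h2).2.2.2 ?_
  rw [← Nat.find_spec hcont]
  congr 1
  exact val_injective (by rw [hH, h3])

/-- For every `F` the set `A_F` is countable and pseudo-bounded. -/
theorem realized_countable_pseudoBounded : Realized (all functional fun F =>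
    and (countable (supportSet F)) (pseudoBounded (supportSet F))) := by
  obtain ⟨a, ha, ha'⟩ := exists_countable_supportSet_index
  obtain ⟨b, hb, hb'⟩ := exists_pseudoBounded_supportSet_index
  obtain ⟨e, he⟩ := exists_index (f := fun z => Part.some (Nat.pair (a z) (b z)))
    (computable_pair.comp ha hb).partrec
  refine ⟨e, fun F z z' hz hz' => ⟨_, by rw [he]; exact Part.mem_some _, _,
    by rw [he]; exact Part.mem_some _, ?_, ?_⟩⟩
  · simpa using ha' F z z' hz hz'
  · simpa using hb' F z z' hz hz'

/-! ### No extensional bound, and the failure of BD-ℕ -/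

/-- No bound on `A_F` is computable from a name of `F` extensionally. -/
theorem not_realized_bounded : ¬ Realized (all functional fun F => bounded (supportSet F)) := by
  rintro ⟨r, hr⟩
  have hbound : ∀ (F : functional.El) (z z' : ℕ), Names F z → Names F z' →
      ∃ u ∈ app r z, ∃ u' ∈ app r z', fst u = fst u' ∧
        ∀ m, Realized (supportSet F m) → m ≤ fst u := fun F z z' hz hz' => by
    obtain ⟨u, hu, u', hu', h⟩ := hr F z z' hz hz'
    obtain ⟨h1, h2⟩ := exNat_rel.1 h
    refine ⟨u, hu, u', hu', h1, fun m ⟨e, he⟩ => ?_⟩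
    obtain ⟨_, -, _, -, h3⟩ := allNat_rel.1 h2 m
    obtain ⟨_, -, _, -, h4⟩ := h3 e e he
    exact h4
  obtain ⟨q, hq⟩ := exists_index (f := fun z => (app r z).map fst)
    ((app_partrec.comp (Computable.const r) Computable.id).map
      (computable_fst.comp Computable.snd))
  have hzero : functional.rel 0 0 := functional_rel fun g e e' _ _ => ⟨0, by simp [app_zero]⟩
  obtain ⟨F₀, hF₀, -⟩ := exists_named hzero
  obtain ⟨u₀, hu₀, -⟩ := hbound F₀ 0 0 hF₀ hF₀
  set b := fst u₀
  -- Here `b` is the bound computed from the name `0` of the zero functional. The new functional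
  -- reads `g (b + 1)` as a number of steps and asks whether, within that time, the bound computed
  -- from its own name `z` turns out to be `b`.
  obtain ⟨z, hz⟩ := exists_fixed_index (f := fun z g => (app g (b + 1)).map fun n =>
    bif haltsWith (n, q, z, b) then 1 else 0) (by
    refine Partrec.map (app_partrec.comp Computable.snd (Computable.const (b + 1)))
      (Computable.cond (computable_haltsWith.comp ?_) (Computable.const 1) (Computable.const 0))
    exact Computable.snd.pair ((Computable.const q).pair
      ((Computable.fst.comp Computable.fst).pair (Computable.const b))))
  have hval : ∀ (g : baire.El) (e : ℕ), Names g e → app z e =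
      Part.some (bif haltsWith (val g (b + 1), q, z, b) then 1 else 0) := fun g e he => by
    rw [hz, he.app_eq, Part.map_some]
  obtain ⟨F, hF, -⟩ := exists_named (functional_rel (z := z) (z' := z) fun g e e' he he' =>
    ⟨_, by rw [hval g e he]; exact Part.mem_some _, by rw [hval g e' he']; exact Part.mem_some _⟩)
  have hfval : ∀ g, fval F g = bif haltsWith (val g (b + 1), q, z, b) then 1 else 0 := fun g => by
    obtain ⟨e, he⟩ := exists_names g
    exact Part.some_injective <| by rw [← hF.app_eq_fval he, hval g e he]
  by_cases hex : ∃ t, haltsWith (t, q, z, b) = true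
  · obtain ⟨t, ht⟩ := hex
    obtain ⟨d, -, hd⟩ := exists_extend_index
    -- If the bound is `b`, the sequence with the single possibly nonzero entry `t` at `b + 1` puts
    -- `b + 1` into `A_F`.
    obtain ⟨g, hg, hgd, -⟩ := exists_named_of_app_eq (hd (b + 1, List.replicate (b + 2) t))
      (hd (b + 1, List.replicate (b + 2) t))
    have hgt : val g (b + 1) = t := by simp [hg, extend]
    have hne : fval F g ≠ fval F zeroFun := by
      rw [hfval, hfval, hgt, ht, val_zeroFun]
      -- Nothing halts within `0` steps, so `F 0 = 0`.
      simp [haltsWith, Code.evaln]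
    obtain ⟨u, hu, -, -, -, hmax⟩ := hbound F z z hF hF
    have hle := hmax (b + 1) ⟨_, supportSet_rel_one (n := b + 2) hgd hgd
      (fun x hx => by rw [hg]; exact if_pos hx)
      (fun x hx => by rw [hg]; exact extend_of_length_le (by simpa using hx)) hne⟩
    have hb := mem_app_of_haltsWith ht
    rw [hq, Part.eq_some_iff.2 hu, Part.map_some, Part.mem_some_iff] at hb
    omega
  -- If the bound is never seen to be `b`, then `z` and `0` name the same functional, and
  -- extensionality forces the bound from `z` to be `b` after all.
  · have hFF : F = F₀ := by
      obtain ⟨G, hGz, hG0⟩ := exists_named (functional_rel (z := z) (z' := 0) fun g e e' he _ =>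
        ⟨0, by simp [hval g e he, Bool.eq_false_iff.2 fun h => hex ⟨_, h⟩], by simp [app_zero]⟩)
      exact (hF.unique hGz).trans (hG0.unique hF₀)
    obtain ⟨v, hv, v', hv', hvv, -⟩ := hbound F₀ 0 z hF₀ (hFF ▸ hF)
    refine hex (exists_haltsWith ?_)
    rw [hq, Part.eq_some_iff.2 hv', Part.map_some, ← hvv, Part.mem_unique hv hu₀]
    exact Part.mem_some _

/-- BD-ℕ is not realized. -/
theorem not_realized_BDN : ¬ Realized BDN := by
  rintro ⟨e, he⟩
  obtain ⟨r, hr⟩ := realized_countable_pseudoBounded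
  obtain ⟨q, hq⟩ := exists_index (f := fun z => (app r z).bind (app e))
    (Partrec.bind (app_partrec.comp (Computable.const r) Computable.id)
      (app_partrec.comp (Computable.const e) Computable.snd))
  refine not_realized_bounded ⟨q, fun F z z' hz hz' => ?_⟩
  obtain ⟨u, hu, u', hu', h⟩ := hr F z z' hz hz'
  -- Since sets have no names, the one realizer `e` applies to every `A_F`.
  obtain ⟨v, hv, v', hv', h'⟩ := he (supportSet F) u u' h
  refine ⟨v, ?_, v', ?_, h'⟩
  · rw [hq]
    exact Part.mem_bind hu hv
  · rw [hq]
    exact Part.mem_bind hu' hv'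

end PER
end ExtReal

theorem mainTheorem4 :
    (¬ ExtReal.PER.Realized ExtReal.BDN) ∧
    ExtReal.PER.Realized (ExtReal.PER.neg ExtReal.BDN) ∧
    ExtReal.PER.Realized
      (ExtReal.PER.all ExtReal.PER.functional fun F =>
        ExtReal.PER.and (ExtReal.countable (ExtReal.supportSet F))
          (ExtReal.pseudoBounded (ExtReal.supportSet F))) ∧
    (¬ ExtReal.PER.Realized
      (ExtReal.PER.all ExtReal.PER.functional fun F =>
        ExtReal.bounded (ExtReal.supportSet F))) := 
  ⟨ExtReal.PER.not_realized_BDN, ExtReal.PER.realized_neg ExtReal.PER.not_realized_BDN,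
    ExtReal.PER.realized_countable_pseudoBounded, ExtReal.PER.not_realized_bounded⟩
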